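/- Let $K$ be any field. A (left) Leibniz algebra over $K$ is a $K$-vector space $L$ with a bilinear product satisfying $a(bc)=(ab)c+b(ac)$ for all $a,b,c\in L$. For subspaces $S,T\subseteq L$ write $ST=[S,T]$ for the span of all products $st$ with $s\in S$, $t\in T$, and put $S^1=S$, $S^{n+1}=[S,S^n]$; a subalgebra $S$ is nilpotent if $S^n=0$ for some $n$. An algebra is solvable if its derived series $L^{(0)}=L$, $L^{(n+1)}=[L^{(n)},L^{(n)}]$ reaches $0$. Ideals are two-sided; the nilradical $\mathrm{nilrad}(L)$ is the largest nilpotent ideal of $L$; $\mathrm{Leib}(L)=\mathrm{span}\{y^2 : y\in L\}$; $\langle x\rangle$ is the subalgebra generated by $x$; and $L$ is cyclic if $L=\langle z\rangle$ for some $z\in L$. **Theorem.** Let $L$ be a finite-dimensional, nonnilpotent, solvable Leibniz algebra over $K$ all of whose proper subalgebras are nilpotent. Then there are subspaces $A,N\subseteq L$, an element $x\in L$, $x\neq 0$, an integer $k\ge 0$, linearly independent elements $a_0,\dots,a_k\in L$ and scalars $c_0,\dots,c_k\in K$ with $c_0\neq 0$ such that 1. $A=\mathrm{nilrad}(L)$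 and $L=A\oplus\mathrm{span}\{x\}$ as vector spaces; 2. $N$ is an ideal of $L$, and $A=\mathrm{span}\{a_0,\dots,a_k\}\oplus N$ as vector spaces; 3. $xa_i=a_{i+1}$ for $0\le i<k$, and $xa_k=c_0a_0+c_1a_1+\cdots+c_ka_k$; 4. the polynomial $p(\lambda)=\lambda^{k+1}-c_k\lambda^k-\cdots-c_1\lambda-c_0$ is irreducible in $K[\lambda]$; 5. $N=\langle x\rangle^2+(\mathrm{span}\{a_0,\dots,a_k\})^2$; 6. $A^3\le \mathrm{Leib}(L)$; 7. $L$ is cyclic or $\mathrm{Leib}(L)\le N$. -/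

import Mathlib

/-- The left Leibniz identity `a(bc) = (ab)c + b(ac)`.  A (left) Leibniz algebra over a field `K`
is a `K`-vector space `L` with a bilinear product (`NonUnitalNonAssocRing L`, `Module K L`,
`IsScalarTower K L L`, `SMulCommClass K L L`) satisfying this identity. -/
class IsLeftLeibniz (L : Type*) [NonUnitalNonAssocRing L] : Prop where
  leibniz : ∀ a b c : L, a * (b * c) = (a * b) * c + b * (a * c)

namespace LeibnizAlg

section

variable {K : Type*} [Field K] {L : Type*} [NonUnitalNonAssocRing L] [Module K L]
  [IsScalarTower K L L] [SMulCommClass K L L]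

/-- The product `[S, T]` of two subspaces: the span of all products `s * t`. -/
def prod (S T : Submodule K L) : Submodule K L :=
  Submodule.map₂ (LinearMap.mul K L) S T

/-- The lower central series of a subalgebra `S`: `lcs S n` is `S ^ (n + 1)`, where `S ^ 1 = S` and
`S ^ (n + 1) = [S, S ^ n]`. -/
def lcs (S : Submodule K L) : ℕ → Submodule K L
  | 0 => S
  | n + 1 => prod S (lcs S n)

/-- A subalgebra (or an ideal, or `⊤`, the whole algebra) is nilpotent if its lower central series
reaches zero. -/
def Nilpotent (S : Submodule K L) : Prop := ∃ n, lcs S n = ⊥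

/-- The derived series of a subalgebra. -/
def derived (S : Submodule K L) : ℕ → Submodule K L
  | 0 => S
  | n + 1 => prod (derived S n) (derived S n)

/-- A subalgebra (or `⊤`, the whole algebra) is solvable if its derived series reaches zero. -/
def Solvable (S : Submodule K L) : Prop := ∃ n, derived S n = ⊥

/-- Two-sided ideals. -/
def IsIdeal (I : Submodule K L) : Prop :=
  ∀ u ∈ I, ∀ y : L, y * u ∈ I ∧ u * y ∈ I

/-- `A` is the nilradical: the largest nilpotent ideal. -/
def IsNilradical (A : Submodule K L) : Prop :=
  IsGreatest {I : Submodule K L | IsIdeal I ∧ Nilpotent I} A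

variable (K)

/-- The subalgebra `⟨x⟩` generated by `x`, as a subspace. -/
def gen (x : L) : Submodule K L :=
  (NonUnitalAlgebra.adjoin K {x}).toSubmodule

variable (L)

/-- `Leib(L)`: the span of all squares. -/
def Leib : Submodule K L :=
  Submodule.span K (Set.range fun y : L => y * y)

/-- `L` is cyclic: it is generated as an algebra by one element. -/
def IsCyclicAlg : Prop := ∃ z : L, gen K z = ⊤

end

end LeibnizAlg

/-! Solvability puts `L²` inside a hyperplane `A`, which is nilpotent by minimality. It is the
nilradical: extending `A` by an element acting nilpotently would make `L` nilpotent
(`nilpotent_top_of_nilpotent_mulLeft`). An element outside `A`, corrected by one of `Leib(L)`, gives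
`x` in the null part `Z` of the Fitting decomposition `L = Z ⊕ R` of its own left multiplication
(`exists_mem_ker_mulLeft`). Nonnilpotency forces `R ≠ 0`. The engine is then: left multiplication by
`x` is nilpotent on any proper subalgebra containing `x` but injective on `R`, so a subalgebra
containing `x` and a nonzero element of `R` is all of `L`.

Let `W` be the span of a cyclic family (`exists_cyclic_family`), taken in `Leib(L) ∩ R` if that is
nonzero and in `R` otherwise, and let `P = ⟨x⟩²`. By `table_consequences`, `span {x} + W + P + W²`
is a subalgebra, hence is `L`; so `A = W + N` with `N = P + W²` inside `Z`. If `W ≤ Leib(L)`, then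
`x + a₀` generates `L`; otherwise `Leib(L) ≤ A ∩ Z = N`. -/

namespace LeibnizAlg

/-! ### Linear algebra: cyclic families and Fitting decomposition -/

section LinearAlgebra

variable {K V : Type*} [Field K] [AddCommGroup V] [Module K V] [FiniteDimensional K V]

/-- An endomorphism without proper invariant subspaces has irreducible minimal polynomial. -/
theorem irreducible_minpoly_of_simple [Nontrivial V] (g : Module.End K V)
    (hg : ∀ U : Submodule K V, (∀ u ∈ U, g u ∈ U) → U = ⊥ ∨ U = ⊤) :
    Irreducible (minpoly K g) := by
  have hint : IsIntegral K g := Algebra.IsIntegral.isIntegral g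
  refine (irreducible_iff_prime.mpr ⟨minpoly.ne_zero hint, minpoly.not_isUnit K g, ?_⟩)
  intro q r hqr
  have h0 : Polynomial.aeval g q * Polynomial.aeval g r = 0 := by
    rw [← map_mul]; exact (minpoly.dvd_iff.mp hqr)
  -- `r(g)` commutes with `g`, so its kernel is invariant: `r(g)` is zero or bijective.
  rcases hg (LinearMap.ker (Polynomial.aeval g r)) (fun u hu => by
    have hcomm : Polynomial.aeval g r * g = g * Polynomial.aeval g r := by
      have h := congrArg (Polynomial.aeval g) (mul_comm r Polynomial.X)
      simpa using h
    rw [LinearMap.mem_ker] at hu ⊢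
    have := congrArg (fun F : Module.End K V => F u) hcomm
    simpa [hu] using this) with h | h
  · left
    refine minpoly.dvd K g ?_
    have hinj : Function.Injective (Polynomial.aeval g r) := LinearMap.ker_eq_bot.mp h
    have hsurj := LinearMap.injective_iff_surjective.mp hinj
    ext v
    obtain ⟨u, rfl⟩ := hsurj v
    exact congrArg (fun F : Module.End K V => F u) h0
  · right
    exact minpoly.dvd K g (LinearMap.ker_eq_top.mp h)

/-- An endomorphism without proper invariant subspaces, and injective, has a cyclic basis whose
last vector is mapped back by the coefficients of an irreducible polynomial. -/
theorem exists_cyclic_family_of_simple [Nontrivial V] (g : Module.End K V)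
    (hg : ∀ U : Submodule K V, (∀ u ∈ U, g u ∈ U) → U = ⊥ ∨ U = ⊤)
    (hinj : ∀ v, g v = 0 → v = 0) :
    ∃ (k : ℕ) (a : Fin (k + 1) → V) (c : Fin (k + 1) → K),
      LinearIndependent K a ∧ (∀ i : Fin k, g (a i.castSucc) = a i.succ) ∧
      g (a (Fin.last k)) = ∑ i, c i • a i ∧ c 0 ≠ 0 ∧
      Irreducible (Polynomial.X ^ (k + 1) -
        ∑ i : Fin (k + 1), Polynomial.C (c i) * Polynomial.X ^ (i : ℕ)) := by
  have hint : IsIntegral K g := Algebra.IsIntegral.isIntegral g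
  have hirr := irreducible_minpoly_of_simple g hg
  obtain ⟨v, hv⟩ := exists_ne (0 : V)
  set p := minpoly K g with hp
  have hmonic : p.Monic := minpoly.monic hint
  obtain ⟨k, hk⟩ : ∃ k, p.natDegree = k + 1 :=
    Nat.exists_eq_succ_of_ne_zero (minpoly.natDegree_pos hint).ne'
  have hform : Polynomial.X ^ (k + 1) - ∑ i : Fin (k + 1),
      Polynomial.C (-p.coeff i) * Polynomial.X ^ (i : ℕ) = p := by
    conv_rhs => rw [hmonic.as_sum, hk]
    rw [Finset.sum_range]
    simp [sub_eq_add_neg]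
  -- Kernels of `q(g)` are invariant, so killing the single vector `v` already means `q(g) = 0`.
  have hkill : ∀ q : Polynomial K, Polynomial.aeval g q v = 0 → p ∣ q := by
    intro q hq
    rcases hg (LinearMap.ker (Polynomial.aeval g q)) (fun u hu => by
      have h := congrArg (Polynomial.aeval g) (mul_comm q Polynomial.X)
      rw [LinearMap.mem_ker] at hu ⊢
      have := congrArg (fun F : Module.End K V => F u) h
      simpa [hu] using this) with h | h
    · exact absurd ((Submodule.mem_bot K).mp (h ▸ LinearMap.mem_ker.mpr hq)) hv
    · exact minpoly.dvd K g (LinearMap.ker_eq_top.mp h)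
  refine ⟨k, fun i => (g ^ (i : ℕ)) v, fun i => -p.coeff i, ?_, ?_, ?_, ?_, ?_⟩
  · rw [Fintype.linearIndependent_iff]
    intro b hb
    let q : Polynomial K := ∑ i : Fin (k + 1), Polynomial.C (b i) * Polynomial.X ^ (i : ℕ)
    have hq : Polynomial.aeval g q v = 0 := by
      rw [← hb]
      simp [q, map_sum, Module.algebraMap_end_apply, LinearMap.sum_apply]
    have hdeg : q.degree < p.degree := by
      rw [Polynomial.degree_eq_natDegree hmonic.ne_zero, hk]
      exact Polynomial.degree_sum_fin_lt b
    have hq0 : q = 0 := Polynomial.eq_zero_of_dvd_of_degree_lt (hkill q hq) hdeg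
    intro i
    have := congrArg (fun r : Polynomial K => r.coeff i) hq0
    simpa [q, Polynomial.finsetSum_coeff, Polynomial.coeff_X_pow, Fin.val_inj] using this
  · intro i
    simp [pow_succ']
  · have h : Polynomial.aeval g p v = 0 := by simp [hp]
    rw [← hform] at h
    simp only [map_sub, map_pow, Polynomial.aeval_X, map_sum, map_mul, Polynomial.aeval_C,
      LinearMap.sub_apply, LinearMap.sum_apply, Module.End.mul_apply,
      Module.algebraMap_end_apply, sub_eq_zero] at h
    rw [← h, pow_succ']
    rfl
  · intro h0
    have hroot : p.IsRoot 0 := by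
      rw [Polynomial.IsRoot, ← Polynomial.coeff_zero_eq_eval_zero]
      simpa using h0
    obtain ⟨u, hu⟩ := (Module.End.hasEigenvalue_of_isRoot hroot).exists_hasEigenvector
    exact hu.2 (hinj u (by simpa using hu.apply_eq_smul))
  · rw [hform]; exact hirr

/-- A nonzero invariant subspace on which an endomorphism is injective contains a cyclic family
whose characteristic polynomial is irreducible and different from the indeterminate. -/
theorem exists_cyclic_family (f : Module.End K V) (U : Submodule K V)
    (hU : ∀ u ∈ U, f u ∈ U) (hne : U ≠ ⊥) (hinj : ∀ u ∈ U, f u = 0 → u = 0) :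
    ∃ (k : ℕ) (a : Fin (k + 1) → V) (c : Fin (k + 1) → K),
      LinearIndependent K a ∧ (∀ i, a i ∈ U) ∧ (∀ i : Fin k, f (a i.castSucc) = a i.succ) ∧
      f (a (Fin.last k)) = ∑ i, c i • a i ∧ c 0 ≠ 0 ∧
      Irreducible (Polynomial.X ^ (k + 1) -
        ∑ i : Fin (k + 1), Polynomial.C (c i) * Polynomial.X ^ (i : ℕ)) := by
  obtain ⟨W, ⟨hWne, hWinv, hWU⟩, hWmin⟩ := wellFounded_lt.has_min
    {W : Submodule K V | W ≠ ⊥ ∧ (∀ w ∈ W, f w ∈ W) ∧ W ≤ U} ⟨U, hne, hU, le_rfl⟩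
  have : Nontrivial W := Submodule.nontrivial_iff_ne_bot.mpr hWne
  obtain ⟨k, a, c, h1, h2, h3, h4, h5⟩ := exists_cyclic_family_of_simple (f.restrict hWinv)
    (fun X hX => by
      by_cases hbot : X = ⊥
      · exact Or.inl hbot
      right
      have hmap : X.map W.subtype ≤ W := Submodule.map_subtype_le W X
      have hnot := hWmin (X.map W.subtype) ⟨by
          intro h
          exact hbot (Submodule.map_injective_of_injective W.injective_subtype
            (by rw [h, Submodule.map_bot])), by
          rintro _ ⟨u, hu, rfl⟩
          exact ⟨_, hX u hu, rfl⟩, hmap.trans hWU⟩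
      have heq : X.map W.subtype = W := hmap.eq_of_not_lt hnot
      exact Submodule.map_injective_of_injective W.injective_subtype
        (by rw [heq, Submodule.map_top, Submodule.range_subtype]))
    (fun v hv => Subtype.ext (hinj v (hWU v.2) (congrArg Subtype.val hv)))
  refine ⟨k, fun i => (a i : V), c, ?_, fun i => hWU (a i).2, fun i => ?_, ?_, h4, h5⟩
  · exact h1.map' W.subtype (LinearMap.ker_eq_bot.mpr W.injective_subtype)
  · exact congrArg Subtype.val (h2 i)
  · simpa using congrArg Subtype.val h3

/-- If an endomorphism is injective on an invariant subspace `R`, then an element of `R` lies in an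
invariant subspace as soon as its image does. -/
theorem mem_of_apply_mem {f : Module.End K V} {R U : Submodule K V}
    (hR : ∀ u ∈ R, f u ∈ R) (hinj : ∀ u ∈ R, f u = 0 → u = 0)
    (hU : ∀ u ∈ U, f u ∈ U) {v : V} (hv : v ∈ R) (hfv : f v ∈ U) : v ∈ U := by
  have hinv : ∀ u ∈ U ⊓ R, f u ∈ U ⊓ R := fun u hu => ⟨hU u hu.1, hR u hu.2⟩
  have hi : Function.Injective (f.restrict hinv) := by
    rw [injective_iff_map_eq_zero]
    intro u hu
    exact Subtype.ext (hinj u u.2.2 (congrArg Subtype.val hu))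
  obtain ⟨u, hu⟩ := LinearMap.injective_iff_surjective.mp hi ⟨f v, hfv, hR v hv⟩
  have h0 : v - u = 0 := hinj _ (R.sub_mem hv u.2.2) (by
    rw [map_sub, sub_eq_zero]; exact (congrArg Subtype.val hu).symm)
  rw [sub_eq_zero.mp h0]
  exact u.2.1

theorem mem_of_pow_apply_mem {f : Module.End K V} {R U : Submodule K V}
    (hR : ∀ u ∈ R, f u ∈ R) (hinj : ∀ u ∈ R, f u = 0 → u = 0)
    (hU : ∀ u ∈ U, f u ∈ U) (n : ℕ) {v : V} (hv : v ∈ R) (hfv : (f ^ n) v ∈ U) : v ∈ U := by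
  induction n generalizing v with
  | zero => simpa using hfv
  | succ n ih =>
    rw [pow_succ, Module.End.mul_apply] at hfv
    exact mem_of_apply_mem hR hinj hU hv (ih (hR v hv) hfv)

/-- Fitting decomposition. -/
theorem exists_fitting (f : Module.End K V) :
    ∃ n, 0 < n ∧ IsCompl (LinearMap.ker (f ^ n)) (LinearMap.range (f ^ n)) := by
  obtain ⟨n, hn⟩ := Filter.eventually_atTop.mp f.eventually_isCompl_ker_pow_range_pow
  -- A positive exponent ensures that the kernel of `f` lies in that of the power.
  exact ⟨n + 1, n.succ_pos, hn _ n.le_succ⟩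

end LinearAlgebra

end LeibnizAlg

namespace LeibnizAlg

/-! ### Products of subspaces, `Leib(L)` and lower central series -/

section Algebra

set_option linter.unusedSectionVars false

variable {K : Type*} [Field K] {L : Type*} [NonUnitalNonAssocRing L] [Module K L]
  [IsScalarTower K L L] [SMulCommClass K L L]

theorem mul_mem_prod {S T : Submodule K L} {s t : L} (hs : s ∈ S) (ht : t ∈ T) :
    s * t ∈ prod S T :=
  Submodule.apply_mem_map₂ (LinearMap.mul K L) hs ht

theorem prod_le {S T U : Submodule K L} : prod S T ≤ U ↔ ∀ s ∈ S, ∀ t ∈ T, s * t ∈ U :=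
  Submodule.map₂_le

theorem prod_mono {S S' T T' : Submodule K L} (hS : S ≤ S') (hT : T ≤ T') :
    prod S T ≤ prod S' T' :=
  Submodule.map₂_le_map₂ hS hT

theorem prod_sup_left (S S' T : Submodule K L) : prod (S ⊔ S') T = prod S T ⊔ prod S' T :=
  Submodule.map₂_sup_left _ _ _ _

theorem prod_sup_right (S T T' : Submodule K L) : prod S (T ⊔ T') = prod S T ⊔ prod S T' :=
  Submodule.map₂_sup_right _ _ _ _

/-- A subspace closed under products, as a subalgebra. -/
def subalgebraOfProd (S : Submodule K L) (h : prod S S ≤ S) : NonUnitalSubalgebra K L :=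
  { S with mul_mem' := fun hs ht => h (mul_mem_prod hs ht) }

theorem self_mem_gen (x : L) : x ∈ gen K x :=
  NonUnitalAlgebra.subset_adjoin K (Set.mem_singleton x)

theorem prod_gen_le (x : L) : prod (gen K x) (gen K x) ≤ gen K x :=
  prod_le.mpr fun _ hs _ ht => (NonUnitalAlgebra.adjoin K {x}).mul_mem hs ht

theorem gen_le {x : L} {S : Submodule K L} (h : prod S S ≤ S) (hx : x ∈ S) : gen K x ≤ S := by
  have : NonUnitalAlgebra.adjoin K {x} ≤ subalgebraOfProd S h :=
    NonUnitalAlgebra.adjoin_le (Set.singleton_subset_iff.mpr hx)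
  exact this

/-- The subalgebra generated by `x` is spanned by `x` and the products. -/
theorem gen_le_span_sup (x : L) :
    gen K x ≤ Submodule.span K {x} ⊔ prod (gen K x) (gen K x) := by
  have hle : Submodule.span K {x} ⊔ prod (gen K x) (gen K x) ≤ gen K x :=
    sup_le ((Submodule.span_singleton_le_iff_mem _ _).mpr (self_mem_gen x)) (prod_gen_le x)
  exact gen_le ((prod_mono hle hle).trans le_sup_right)
    (Submodule.mem_sup_left (Submodule.mem_span_singleton_self x))

variable [IsLeftLeibniz L]

theorem leibniz (a b c : L) : a * (b * c) = (a * b) * c + b * (a * c) :=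
  IsLeftLeibniz.leibniz a b c

theorem mul_mul_eq (a b c : L) : (a * b) * c = a * (b * c) - b * (a * c) := by
  rw [leibniz a b c, add_sub_cancel_right]

theorem sq_mem_Leib (x : L) : x * x ∈ Leib K L := Submodule.subset_span ⟨x, rfl⟩

theorem mul_add_mul_mem_Leib (x y : L) : x * y + y * x ∈ Leib K L := by
  have h := (Leib K L).sub_mem ((Leib K L).sub_mem (sq_mem_Leib (K := K) (x + y))
    (sq_mem_Leib x)) (sq_mem_Leib y)
  have e : (x + y) * (x + y) - x * x - y * y = x * y + y * x := by
    rw [add_mul, mul_add, mul_add]; abel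
  rwa [e] at h

/-- Elements of `Leib(L)` annihilate `L` from the left. -/
theorem Leib_mul {u : L} (hu : u ∈ Leib K L) (y : L) : u * y = 0 := by
  induction hu using Submodule.span_induction with
  -- `(zz)y = z(zy) - z(zy)`.
  | mem u h => obtain ⟨z, rfl⟩ := h; simp [mul_mul_eq]
  | zero => simp
  | add u v _ _ hu hv => rw [add_mul, hu, hv, add_zero]
  | smul c u _ hu => rw [smul_mul_assoc, hu, smul_zero]

/-- `y(zz) = (yz)z + z(yz)` is a polarized square. -/
theorem mul_Leib {u : L} (hu : u ∈ Leib K L) (y : L) : y * u ∈ Leib K L := by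
  induction hu using Submodule.span_induction with
  | mem u h =>
    obtain ⟨z, rfl⟩ := h
    rw [leibniz]
    exact mul_add_mul_mem_Leib (y * z) z
  | zero => simp
  | add u v _ _ hu hv => rw [mul_add]; exact Submodule.add_mem _ hu hv
  | smul c u _ hu => rw [mul_smul_comm]; exact Submodule.smul_mem _ c hu

theorem prod_Leib_left {S : Submodule K L} (hS : S ≤ Leib K L) (T : Submodule K L) :
    prod S T = ⊥ :=
  le_bot_iff.mp (prod_le.mpr fun s hs t _ => by simp [Leib_mul (hS hs) t])

theorem mul_mem_prod_of_mul_mem {y : L} {S T : Submodule K L} (hS : ∀ s ∈ S, y * s ∈ S)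
    (hT : ∀ t ∈ T, y * t ∈ T) {u : L} (hu : u ∈ prod S T) : y * u ∈ prod S T := by
  have h : prod S T ≤ (prod S T).comap (LinearMap.mulLeft K y) := prod_le.mpr fun s hs t ht => by
    simp only [Submodule.mem_comap, LinearMap.mulLeft_apply]
    rw [leibniz]
    exact Submodule.add_mem _ (mul_mem_prod (hS s hs) ht) (mul_mem_prod hs (hT t ht))
  exact h hu

theorem mul_mem_lcs {y : L} {S : Submodule K L} (hS : ∀ s ∈ S, y * s ∈ S) (n : ℕ) :
    ∀ u ∈ lcs S n, y * u ∈ lcs S n := by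
  induction n with
  | zero => exact hS
  | succ n ih => exact fun u hu => mul_mem_prod_of_mul_mem hS ih hu

/-- The identity `(ab)t = a(bt) - b(at)` shortens the left factor. The extra `1` appears because
`lcs S i` is `S^(i+1)`. -/
theorem lcs_mul_lcs {S : Submodule K L} (i j : ℕ) :
    prod (lcs S i) (lcs S j) ≤ lcs S (i + j + 1) := by
  induction i generalizing j with
  | zero => rw [zero_add]; exact le_rfl
  | succ i ih =>
    refine prod_le.mpr fun s hs t ht => ?_
    have h : lcs S (i + 1) ≤
        (lcs S (i + 1 + j + 1)).comap (LinearMap.mulRight K t) := prod_le.mpr fun a ha b hb => by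
      simp only [Submodule.mem_comap, LinearMap.mulRight_apply]
      rw [mul_mul_eq]
      refine Submodule.sub_mem _ ?_ ?_
      · have := mul_mem_prod (T := lcs S (i + j + 1)) ha (ih j (mul_mem_prod hb ht))
        rwa [show i + 1 + j + 1 = i + j + 1 + 1 by ring]
      · have := ih (j + 1) (mul_mem_prod hb (mul_mem_prod ha ht))
        rwa [show i + 1 + j + 1 = i + (j + 1) + 1 by ring]
    exact h hs

theorem prod_isIdeal {A : Submodule K L} (hA : IsIdeal A) : IsIdeal (prod A A) := by
  intro u hu y
  refine ⟨mul_mem_prod_of_mul_mem (fun s hs => (hA s hs y).1) (fun s hs => (hA s hs y).1) hu, ?_⟩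
  have h : prod A A ≤ (prod A A).comap (LinearMap.mulRight K y) := prod_le.mpr fun a ha b hb => by
    simp only [Submodule.mem_comap, LinearMap.mulRight_apply]
    rw [mul_mul_eq]
    exact Submodule.sub_mem _ (mul_mem_prod ha (hA b hb y).2) (mul_mem_prod hb (hA a ha y).2)
  exact h hu

/-- A nilpotent subalgebra is contained in any subspace of `Leib(L)` that spans it modulo its
square. -/
theorem le_of_le_sup_prod {A P : Submodule K L} (hnil : Nilpotent A)
    (hP : P ≤ Leib K L) (h : A ≤ P ⊔ prod A A) : A ≤ P := by
  have key : ∀ n, A ≤ P ⊔ lcs A n := by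
    intro n
    induction n with
    | zero => exact le_sup_right
    | succ n ih =>
      -- `P` annihilates from the left, so only the `lcs A n` part of the left factor survives.
      have h1 : prod A A ≤ lcs A (n + 1) := by
        refine (prod_mono ih le_rfl).trans ?_
        rw [prod_sup_left, prod_Leib_left hP, bot_sup_eq]
        exact lcs_mul_lcs n 0
      exact h.trans (sup_le_sup_left h1 P)
  obtain ⟨n, hn⟩ := hnil
  simpa [hn] using key n

end Algebra

end LeibnizAlg

namespace LeibnizAlg

/-! ### Nilpotent extensions, Fitting components and the multiplication table -/

section Structure

set_option linter.unusedSectionVars false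

variable {K : Type*} [Field K] {L : Type*} [NonUnitalNonAssocRing L] [Module K L]
  [IsScalarTower K L L] [SMulCommClass K L L] [IsLeftLeibniz L]

theorem isIdeal_of_prod_top_le {A : Submodule K L} (hA : prod ⊤ ⊤ ≤ A) : IsIdeal A :=
  fun _ _ _ => ⟨hA (mul_mem_prod trivial trivial), hA (mul_mem_prod trivial trivial)⟩

theorem mulLeft_pow_mem_lcs {S : Submodule K L} {x u : L} (hx : x ∈ S) (hu : u ∈ S) (n : ℕ) :
    (LinearMap.mulLeft K x ^ n) u ∈ lcs S n := by
  induction n with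
  | zero => exact hu
  | succ n ih =>
    rw [pow_succ', Module.End.mul_apply]
    exact mul_mem_prod hx ih

/-- An extension of a nilpotent ideal by an element acting nilpotently is nilpotent. -/
theorem nilpotent_top_of_nilpotent_mulLeft {A : Submodule K L} {x : L} (hA : prod ⊤ ⊤ ≤ A)
    (hnil : Nilpotent A) (hsup : A ⊔ Submodule.span K {x} = ⊤) {m : ℕ}
    (hx : LinearMap.mulLeft K x ^ m = 0) : Nilpotent (⊤ : Submodule K L) := by
  have hid := isIdeal_of_prod_top_le hA
  have hst : ∀ y : L, ∀ i, ∀ u ∈ lcs A i, y * u ∈ lcs A i := fun y i =>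
    mul_mem_lcs (fun s hs => (hid s hs y).1) i
  have key : ∀ i, ∃ n, lcs (⊤ : Submodule K L) n ≤ lcs A i := by
    intro i
    induction i with
    | zero => exact ⟨1, hA⟩
    | succ i ih =>
      obtain ⟨n, hn⟩ := ih
      -- Modulo `lcs A (i + 1)`, left factors from `A` kill `lcs A i`, so only the `x` part of each
      -- factor acts; `m` factors suffice.
      have step : ∀ j, lcs (⊤ : Submodule K L) (n + j) ≤
          (lcs A i).map (LinearMap.mulLeft K x ^ j) ⊔ lcs A (i + 1) := by
        intro j
        induction j with
        | zero =>
          refine hn.trans (le_trans ?_ le_sup_left)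
          simp [Module.End.one_eq_id]
        | succ j ihj =>
          refine prod_le.mpr fun y _ t ht => ?_
          obtain ⟨b, hb, w, hw, rfl⟩ := Submodule.mem_sup.mp (hsup ▸ Submodule.mem_top (x := y))
          obtain ⟨c, rfl⟩ := Submodule.mem_span_singleton.mp hw
          obtain ⟨t1, ht1, v, hv, rfl⟩ := Submodule.mem_sup.mp (ihj ht)
          obtain ⟨u, hu, rfl⟩ := ht1
          have hju : (LinearMap.mulLeft K x ^ j) u ∈ lcs A i := by
            clear ihj ht
            induction j with
            | zero => exact hu
            | succ j ih =>
              rw [pow_succ', Module.End.mul_apply]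
              exact hst x i _ ih
          rw [mul_add, add_mul b]
          refine add_mem (add_mem ?_ ?_) ?_
          · exact Submodule.mem_sup_right (mul_mem_prod hb hju)
          · refine Submodule.mem_sup_left ⟨c • u, Submodule.smul_mem _ c hu, ?_⟩
            rw [pow_succ', Module.End.mul_apply, map_smul, map_smul, smul_mul_assoc]
            rfl
          · exact Submodule.mem_sup_right (hst _ _ _ hv)
      refine ⟨n + m, (step m).trans ?_⟩
      simp [hx]
  obtain ⟨i, hi⟩ := hnil
  obtain ⟨n, hn⟩ := key i
  exact ⟨n, le_bot_iff.mp (hi ▸ hn)⟩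

theorem isCompl_span_of_isCoatom {A : Submodule K L} (hA : IsCoatom A) {x : L} (hx : x ∉ A) :
    IsCompl A (Submodule.span K {x}) := by
  have hx0 : x ≠ 0 := fun h => hx (h ▸ A.zero_mem)
  constructor
  · exact (Submodule.disjoint_span_singleton' hx0).mpr hx
  · rw [codisjoint_iff]
    refine hA.2 _ (lt_of_le_of_ne le_sup_left fun h => hx ?_)
    rw [h]
    exact Submodule.mem_sup_right (Submodule.mem_span_singleton_self x)

/-- Fitting components multiply: the null component maps the one component to itself. -/
theorem mul_mem_range_of_mem_ker {x : L} {n : ℕ}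
    (hcompl : IsCompl (LinearMap.ker (LinearMap.mulLeft K x ^ n))
      (LinearMap.range (LinearMap.mulLeft K x ^ n)))
    {u v : L} (hu : u ∈ LinearMap.ker (LinearMap.mulLeft K x ^ n))
    (hv : v ∈ LinearMap.range (LinearMap.mulLeft K x ^ n)) :
    u * v ∈ LinearMap.range (LinearMap.mulLeft K x ^ n) ∧
      v * u ∈ LinearMap.range (LinearMap.mulLeft K x ^ n) := by
  set f := LinearMap.mulLeft K x with hf
  set R := LinearMap.range (f ^ n) with hR
  have hfR : ∀ w ∈ R, f w ∈ R := by
    rintro _ ⟨w, rfl⟩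
    exact ⟨f w, by rw [← Module.End.mul_apply, ← pow_succ, pow_succ', Module.End.mul_apply]⟩
  have hfn : ∀ w, (f ^ n) w ∈ R := fun w => ⟨w, rfl⟩
  have hRn : ∀ w ∈ R, ∃ w' ∈ R, (f ^ n) w' = w := by
    rintro _ ⟨w, rfl⟩
    obtain ⟨a, ha, b, hb, rfl⟩ := Submodule.mem_sup.mp
      (hcompl.sup_eq_top ▸ Submodule.mem_top (x := w))
    exact ⟨b, hb, by rw [map_add, LinearMap.mem_ker.mp ha, zero_add]⟩
  have hleib : ∀ a b, f (a * b) = f a * b + a * f b := fun a b => leibniz x a b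
  have key : ∀ i : ℕ, ∀ u, (f ^ i) u = 0 → ∀ v ∈ R, u * v ∈ R ∧ v * u ∈ R := by
    intro i
    induction i with
    | zero => intro u hu v _; simp only [pow_zero, Module.End.one_apply] at hu; simp [hu]
    | succ i ih =>
      intro u hu v hv
      have ihu := ih (f u) (by rwa [pow_succ, Module.End.mul_apply] at hu)
      -- Modulo `R`, powers of `f` commute with multiplication by `u`: the Leibniz error involves `f
      -- u`, which a smaller power of `f` kills.
      have step : ∀ m : ℕ, ∀ w ∈ R, (f ^ m) w ∈ R ∧ (f ^ m) (u * w) - u * (f ^ m) w ∈ R ∧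
          (f ^ m) (w * u) - (f ^ m) w * u ∈ R := by
        intro m
        induction m with
        | zero => intro w hw; simpa using hw
        | succ m ihm =>
          intro w hw
          obtain ⟨h1, h2, h3⟩ := ihm w hw
          simp only [pow_succ', Module.End.mul_apply]
          refine ⟨hfR _ h1, ?_, ?_⟩
          · have := R.add_mem (hfR _ h2) (ihu _ h1).1
            rw [map_sub, hleib u] at this
            convert this using 1
            abel
          · have := R.add_mem (hfR _ h3) (ihu _ h1).2
            rw [map_sub, hleib _ u] at this
            convert this using 1
            abel
      obtain ⟨w, hw, rfl⟩ := hRn v hv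
      obtain ⟨-, h2, h3⟩ := step n w hw
      refine ⟨?_, ?_⟩
      · simpa using R.sub_mem (hfn (u * w)) h2
      · simpa using R.sub_mem (hfn (w * u)) h3
  exact key n u hu v hv

/-- The multiplication table of `span {x} ⊕ W ⊕ P ⊕ W²`, and its consequences. -/
theorem table_consequences {X W P : Submodule K L} (hP : P ≤ Leib K L)
    (hXX : prod X X ≤ P) (hXP : prod X P ≤ P) (hXW : prod X W ≤ W) (hWX : prod W X ≤ W)
    (hWP : prod W P = ⊥) (hWQ : prod W (prod W W) = ⊥) (hQW : prod (prod W W) W = ⊥) :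
    prod (X ⊔ (W ⊔ (P ⊔ prod W W))) (X ⊔ (W ⊔ (P ⊔ prod W W))) ≤ X ⊔ (W ⊔ (P ⊔ prod W W)) ∧
    (X ⊔ (W ⊔ (P ⊔ prod W W)) = ⊤ → IsIdeal (P ⊔ prod W W)) ∧
    prod (W ⊔ (P ⊔ prod W W)) (prod (W ⊔ (P ⊔ prod W W)) (W ⊔ (P ⊔ prod W W))) = ⊥ := by
  have hXQ : prod X (prod W W) ≤ prod W W := prod_le.mpr fun x hx q hq =>
    mul_mem_prod_of_mul_mem (fun w hw => hXW (mul_mem_prod hx hw))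
      (fun w hw => hXW (mul_mem_prod hx hw)) hq
  -- Left multiplication by `W²` reduces to iterated left multiplications by `W`.
  have hQ : ∀ {Y V : Submodule K L}, (∀ w ∈ W, ∀ w' ∈ W, ∀ y ∈ Y, w * (w' * y) ∈ V) →
      prod (prod W W) Y ≤ V := by
    intro Y V h
    refine prod_le.mpr fun q hq y hy => ?_
    have hle : prod W W ≤ V.comap (LinearMap.mulRight K y) := prod_le.mpr fun a ha b hb => by
      simp only [Submodule.mem_comap, LinearMap.mulRight_apply]
      rw [mul_mul_eq]
      exact V.sub_mem (h a ha b hb y hy) (h b hb a ha y hy)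
    exact hle hq
  have zero_of : ∀ {S T : Submodule K L}, prod S T = ⊥ → ∀ s ∈ S, ∀ t ∈ T, s * t = 0 :=
    fun h s hs t ht => (Submodule.mem_bot K).mp (h ▸ mul_mem_prod hs ht)
  have hQX : prod (prod W W) X ≤ prod W W := hQ fun w hw w' hw' y hy =>
    mul_mem_prod hw (hWX (mul_mem_prod hw' hy))
  have hQP : prod (prod W W) P = ⊥ := le_bot_iff.mp <| hQ fun w hw w' hw' y hy => by
    simp [zero_of hWP w' hw' y hy]
  have hQQ : prod (prod W W) (prod W W) = ⊥ := le_bot_iff.mp <| hQ fun w hw w' hw' y hy => by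
    simp [zero_of hWQ w' hw' y hy]
  have hPX := prod_Leib_left hP
  refine ⟨?_, ?_, ?_⟩
  · simp only [prod_sup_left, prod_sup_right, hPX, hWP, hWQ, hQW, hQP, hQQ, bot_sup_eq, sup_bot_eq]
    have iW : W ≤ X ⊔ (W ⊔ (P ⊔ prod W W)) := le_sup_left.trans le_sup_right
    have iP : P ≤ X ⊔ (W ⊔ (P ⊔ prod W W)) := le_sup_left.trans (le_sup_right.trans le_sup_right)
    have iQ : prod W W ≤ X ⊔ (W ⊔ (P ⊔ prod W W)) :=
      le_sup_right.trans (le_sup_right.trans le_sup_right)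
    simp only [sup_le_iff]
    simp only [hXX.trans iP, hXP.trans iP, hXW.trans iW, hXQ.trans iQ, hWX.trans iW, iQ,
      hQX.trans iQ, and_self]
  · intro htop u hu y
    have h1 : prod (X ⊔ (W ⊔ (P ⊔ prod W W))) (P ⊔ prod W W) ≤ P ⊔ prod W W := by
      simp only [prod_sup_left, prod_sup_right, hPX, hWP, hWQ, hQP, hQQ, sup_bot_eq]
      exact sup_le_sup hXP hXQ
    have h2 : prod (P ⊔ prod W W) (X ⊔ (W ⊔ (P ⊔ prod W W))) ≤ P ⊔ prod W W := by
      simp only [prod_sup_left, prod_sup_right, hPX, hQW, hQP, hQQ, bot_sup_eq, sup_bot_eq]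
      exact hQX.trans le_sup_right
    rw [htop] at h1 h2
    exact ⟨h1 (mul_mem_prod trivial hu), h2 (mul_mem_prod hu trivial)⟩
  · simp only [prod_sup_left, prod_sup_right, hPX, hWP, hWQ, hQW, hQP, hQQ, sup_bot_eq]

end Structure

end LeibnizAlg

namespace LeibnizAlg

/-! ### The nilradical and the choice of `x` -/

section Minimal

set_option linter.unusedSectionVars false

variable {K : Type*} [Field K] {L : Type*} [NonUnitalNonAssocRing L] [Module K L]
  [IsScalarTower K L L] [SMulCommClass K L L] [IsLeftLeibniz L]

/-- A maximal nilpotent ideal containing the derived algebra of a nonnilpotent algebra is the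
nilradical. -/
theorem isNilradical_of_isCoatom (hnonnil : ¬ Nilpotent (⊤ : Submodule K L)) {A : Submodule K L}
    (hco : IsCoatom A) (hA : prod ⊤ ⊤ ≤ A) (hnil : Nilpotent A) : IsNilradical A := by
  refine ⟨⟨isIdeal_of_prod_top_le hA, hnil⟩, ?_⟩
  rintro I ⟨hI, m, hm⟩ y hy
  by_contra hyA
  -- One multiplication by `y` moves `L` into `I`; `m` more reach zero.
  refine hnonnil (nilpotent_top_of_nilpotent_mulLeft (m := m + 1) hA hnil
    (isCompl_span_of_isCoatom hco hyA).sup_eq_top ?_)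
  ext u
  have := mulLeft_pow_mem_lcs hy (hI y hy u).2 m
  rw [hm, Submodule.mem_bot] at this
  rw [pow_succ, Module.End.mul_apply]
  exact this

/-- If `L² = L`, the derived series is constant, so solvability gives `L = 0`, which is nilpotent.
-/
theorem exists_isCoatom_prod_top_le [FiniteDimensional K L]
    (hnonnil : ¬ Nilpotent (⊤ : Submodule K L)) (hsolv : Solvable (⊤ : Submodule K L)) :
    ∃ A : Submodule K L, IsCoatom A ∧ prod ⊤ ⊤ ≤ A := by
  rcases eq_top_or_exists_le_coatom (prod (⊤ : Submodule K L) ⊤) with h | h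
  · obtain ⟨n, hn⟩ := hsolv
    have hd : ∀ n, derived (⊤ : Submodule K L) n = ⊤ := by
      intro n
      induction n with
      | zero => rfl
      | succ n ih => rw [derived, ih, h]
    exact absurd ⟨0, (hd n).symm.trans hn⟩ hnonnil
  · exact h

/-- As `Leib(L)` annihilates from the left, `span {x} + (Leib(L) ∩ Z)` is a subalgebra containing
`x`, with all products in `Leib(L) ∩ Z`. -/
theorem gen_le_ker {x : L} {n : ℕ}
    (hx : x ∈ LinearMap.ker (LinearMap.mulLeft K x ^ n)) :
    gen K x ≤ LinearMap.ker (LinearMap.mulLeft K x ^ n) ∧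
      prod (gen K x) (gen K x) ≤ Leib K L ⊓ LinearMap.ker (LinearMap.mulLeft K x ^ n) := by
  set Z := LinearMap.ker (LinearMap.mulLeft K x ^ n)
  have hst : ∀ u ∈ Z, x * u ∈ Z := by
    intro u hu
    have : (LinearMap.mulLeft K x ^ n) (LinearMap.mulLeft K x u) = 0 := by
      rw [← Module.End.mul_apply, ← pow_succ, pow_succ', Module.End.mul_apply,
        LinearMap.mem_ker.mp hu, map_zero]
    exact this
  have hG : prod (Submodule.span K {x} ⊔ Leib K L ⊓ Z) (Submodule.span K {x} ⊔ Leib K L ⊓ Z) ≤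
      Leib K L ⊓ Z := by
    rw [prod_sup_left, prod_Leib_left inf_le_left, sup_bot_eq, prod_sup_right]
    refine sup_le (prod_le.mpr ?_) (prod_le.mpr ?_)
    · intro s hs t ht
      obtain ⟨c, rfl⟩ := Submodule.mem_span_singleton.mp hs
      obtain ⟨d, rfl⟩ := Submodule.mem_span_singleton.mp ht
      rw [smul_mul_assoc, mul_smul_comm]
      exact Submodule.smul_mem _ _ (Submodule.smul_mem _ _ ⟨sq_mem_Leib x, hst x hx⟩)
    · intro s hs t ht
      obtain ⟨c, rfl⟩ := Submodule.mem_span_singleton.mp hs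
      rw [smul_mul_assoc]
      exact Submodule.smul_mem _ _ ⟨mul_Leib ht.1 x, hst t ht.2⟩
  have hgen : gen K x ≤ Submodule.span K {x} ⊔ Leib K L ⊓ Z :=
    gen_le (hG.trans le_sup_right) (Submodule.mem_sup_left (Submodule.mem_span_singleton_self x))
  exact ⟨hgen.trans (sup_le ((Submodule.span_singleton_le_iff_mem _ _).mpr hx) inf_le_right),
    (prod_mono hgen hgen).trans hG⟩

theorem mulLeft_apply_mem_range {f : Module.End K L} {n : ℕ} :
    ∀ u ∈ LinearMap.range (f ^ n), f u ∈ LinearMap.range (f ^ n) := by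
  rintro _ ⟨w, rfl⟩
  exact ⟨f w, by rw [← Module.End.mul_apply, ← pow_succ, pow_succ', Module.End.mul_apply]⟩

theorem eq_zero_of_mem_range {f : Module.End K L} {n : ℕ} (hn : 0 < n)
    (hcompl : IsCompl (LinearMap.ker (f ^ n)) (LinearMap.range (f ^ n))) :
    ∀ u ∈ LinearMap.range (f ^ n), f u = 0 → u = 0 := by
  intro u hu h0
  refine (Submodule.mem_bot K).mp (hcompl.inf_eq_bot ▸ ⟨?_, hu⟩)
  obtain ⟨m, rfl⟩ := Nat.exists_eq_succ_of_ne_zero hn.ne'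
  simp [pow_succ, h0]

/-- Any element may be corrected by a left annihilating one so that it lies in the null component
of its own left multiplication. -/
theorem exists_mem_ker_mulLeft [FiniteDimensional K L] (y : L) :
    ∃ (x : L) (n : ℕ), 0 < n ∧ LinearMap.mulLeft K x = LinearMap.mulLeft K y ∧
      y - x ∈ Leib K L ∧ IsCompl (LinearMap.ker (LinearMap.mulLeft K x ^ n))
        (LinearMap.range (LinearMap.mulLeft K x ^ n)) ∧
      x ∈ LinearMap.ker (LinearMap.mulLeft K x ^ n) := by
  obtain ⟨n, hn, hcompl⟩ := exists_fitting (LinearMap.mulLeft K y)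
  obtain ⟨x, hx, v, hv, hxv⟩ := Submodule.mem_sup.mp
    (hcompl.sup_eq_top ▸ Submodule.mem_top (x := y))
  have hst : ∀ u ∈ Leib K L, LinearMap.mulLeft K y u ∈ Leib K L := fun u hu => mul_Leib hu y
  have hpow : (LinearMap.mulLeft K y ^ n) y ∈ Leib K L := by
    obtain ⟨m, rfl⟩ := Nat.exists_eq_succ_of_ne_zero hn.ne'
    clear hn hcompl hx hv
    induction m with
    | zero => simpa using sq_mem_Leib y
    | succ m ih =>
      rw [pow_succ', Module.End.mul_apply]
      exact hst _ ih
  -- The one component `v` of `y` has the same image as `y` under the `n`th power, and injectivity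
  -- on the range pulls membership in `Leib(L)` back to `v`.
  have hvL : v ∈ Leib K L := by
    refine mem_of_pow_apply_mem mulLeft_apply_mem_range (eq_zero_of_mem_range hn hcompl) hst n hv ?_
    have e : (LinearMap.mulLeft K y ^ n) v = (LinearMap.mulLeft K y ^ n) y := by
      rw [← hxv, map_add, hxv, LinearMap.mem_ker.mp hx, zero_add]
    rwa [e]
  have hmul : LinearMap.mulLeft K x = LinearMap.mulLeft K y := by
    ext u
    simp [← hxv, add_mul, Leib_mul hvL u]
  refine ⟨x, n, hn, hmul, ?_, ?_, ?_⟩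
  · rwa [← hxv, add_sub_cancel_left]
  · rwa [hmul]
  · rwa [hmul]

end Minimal

end LeibnizAlg

/-! ### The structure theorem -/

open LeibnizAlg in
theorem mainTheorem1 {K : Type*} [Field K] {L : Type*} [NonUnitalNonAssocRing L] [Module K L]
    [IsScalarTower K L L] [SMulCommClass K L L] [IsLeftLeibniz L] [FiniteDimensional K L]
    (hnonnil : ¬ LeibnizAlg.Nilpotent (⊤ : Submodule K L))
    (hsolv : LeibnizAlg.Solvable (⊤ : Submodule K L))
    (hmin : ∀ S : NonUnitalSubalgebra K L, S ≠ ⊤ → LeibnizAlg.Nilpotent S.toSubmodule) :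
    ∃ (A N : Submodule K L) (x : L) (k : ℕ) (a : Fin (k + 1) → L) (c : Fin (k + 1) → K),
      LeibnizAlg.IsNilradical A ∧
      IsCompl A (Submodule.span K {x}) ∧
      x ≠ 0 ∧
      LeibnizAlg.IsIdeal N ∧
      LinearIndependent K a ∧
      Disjoint (Submodule.span K (Set.range a)) N ∧
      Submodule.span K (Set.range a) ⊔ N = A ∧
      (∀ i : Fin k, x * a i.castSucc = a i.succ) ∧
      x * a (Fin.last k) = ∑ i, c i • a i ∧
      c 0 ≠ 0 ∧
      Irreducible (Polynomial.X ^ (k + 1) -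
        ∑ i : Fin (k + 1), Polynomial.C (c i) * Polynomial.X ^ (i : ℕ)) ∧
      N = LeibnizAlg.prod (LeibnizAlg.gen K x) (LeibnizAlg.gen K x) ⊔
        LeibnizAlg.prod (Submodule.span K (Set.range a)) (Submodule.span K (Set.range a)) ∧
      LeibnizAlg.prod A (LeibnizAlg.prod A A) ≤ LeibnizAlg.Leib K L ∧
      (LeibnizAlg.IsCyclicAlg K L ∨ LeibnizAlg.Leib K L ≤ N) := by
  have hminS : ∀ S : Submodule K L, prod S S ≤ S → S ≠ ⊤ → Nilpotent S := fun S hS hne =>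
    hmin (subalgebraOfProd S hS) fun h => hne (congrArg NonUnitalSubalgebra.toSubmodule h)
  obtain ⟨A, hco, hA⟩ := exists_isCoatom_prod_top_le hnonnil hsolv
  have hAnil : Nilpotent A := hminS A ((prod_mono le_top le_top).trans hA) hco.1
  have hrad := isNilradical_of_isCoatom hnonnil hco hA hAnil
  have hLA : Leib K L ≤ A := Submodule.span_le.mpr (by
    rintro _ ⟨y, rfl⟩
    exact hA (mul_mem_prod trivial trivial))
  obtain ⟨y, -, hy⟩ := SetLike.exists_of_lt hco.lt_top
  obtain ⟨x, n, hn, -, hyx, hcompl, hxker⟩ := exists_mem_ker_mulLeft (K := K) y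
  have hxA : x ∉ A := fun h => hy (by simpa using A.add_mem (hLA hyx) h)
  have hAx := isCompl_span_of_isCoatom hco hxA
  have hx0 : x ≠ 0 := fun h => hxA (h ▸ A.zero_mem)
  obtain ⟨hgenker, hPle⟩ := gen_le_ker hxker
  have hstR := mulLeft_apply_mem_range (f := LinearMap.mulLeft K x) (n := n)
  have hinjR := eq_zero_of_mem_range hn hcompl
  have hmulR := fun {u v : L} => mul_mem_range_of_mem_ker hcompl (u := u) (v := v)
  have hRne : LinearMap.range (LinearMap.mulLeft K x ^ n) ≠ ⊥ := fun h =>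
    hnonnil (nilpotent_top_of_nilpotent_mulLeft hA hAnil hAx.sup_eq_top
      (LinearMap.range_eq_bot.mp h))
  have hfA : ∀ m, 0 < m → ∀ u, (LinearMap.mulLeft K x ^ m) u ∈ A := by
    intro m hm u
    obtain ⟨m, rfl⟩ := Nat.exists_eq_succ_of_ne_zero hm.ne'
    rw [pow_succ', Module.End.mul_apply]
    exact hA (mul_mem_prod trivial trivial)
  have hRA : LinearMap.range (LinearMap.mulLeft K x ^ n) ≤ A := by
    rintro _ ⟨u, rfl⟩
    exact hfA n hn u
  set Z := LinearMap.ker (LinearMap.mulLeft K x ^ n) with hZ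
  set R := LinearMap.range (LinearMap.mulLeft K x ^ n) with hR
  set P := prod (gen K x) (gen K x) with hP
  have hPL : P ≤ Leib K L := hPle.trans inf_le_left
  have hPZ : P ≤ Z := hPle.trans inf_le_right
  have hRZ : ∀ u, u ∈ R → u ∈ Z → u = 0 := fun u h1 h2 =>
    (Submodule.mem_bot K).mp (hcompl.inf_eq_bot ▸ ⟨h2, h1⟩)
  -- The sole use of minimality beyond the nilpotency of `A`.
  have htop : ∀ T : Submodule K L, prod T T ≤ T → x ∈ T → ∀ w ∈ T, w ∈ R → w ≠ 0 → T = ⊤ := by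
    intro T hT hxT w hwT hwR hw0
    by_contra hne
    obtain ⟨m, hm⟩ := hminS T hT hne
    have h := mulLeft_pow_mem_lcs (K := K) hxT hwT m
    rw [hm] at h
    refine hw0 ((Submodule.mem_bot K).mp (mem_of_pow_apply_mem hstR hinjR ?_ m hwR h))
    simp
  have hZ_of : ∀ S : Submodule K L, (∀ s ∈ S, x * s ∈ S) → S ⊓ R = ⊥ → S ≤ Z := by
    intro S hS hSR s hs
    have h : ∀ m, (LinearMap.mulLeft K x ^ m) s ∈ S := by
      intro m
      induction m with
      | zero => exact hs
      | succ m ih => rw [pow_succ', Module.End.mul_apply]; exact hS _ ih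
    exact (Submodule.mem_bot K).mp (hSR ▸ ⟨h n, s, rfl⟩)
  set X := Submodule.span K {x} with hX
  have hXgen : X ≤ gen K x := (Submodule.span_singleton_le_iff_mem _ _).mpr (self_mem_gen x)
  have hXS : ∀ {S : Submodule K L}, (∀ s ∈ S, x * s ∈ S) → prod X S ≤ S := by
    intro S hS
    refine prod_le.mpr fun u hu s hs => ?_
    obtain ⟨c, rfl⟩ := Submodule.mem_span_singleton.mp hu
    rw [smul_mul_assoc]
    exact S.smul_mem c (hS s hs)
  have hXX : prod X X ≤ P := prod_mono hXgen hXgen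
  have hXP : prod X P ≤ P := prod_mono hXgen (prod_gen_le x)
  -- The two cases differ only in where the cyclic family is chosen and why its products vanish.
  suffices table : ∃ (k : ℕ) (a : Fin (k + 1) → L) (c : Fin (k + 1) → K),
      LinearIndependent K a ∧ (∀ i, a i ∈ R) ∧ (∀ i : Fin k, x * a i.castSucc = a i.succ) ∧
      x * a (Fin.last k) = ∑ i, c i • a i ∧ c 0 ≠ 0 ∧
      Irreducible (Polynomial.X ^ (k + 1) -
        ∑ i : Fin (k + 1), Polynomial.C (c i) * Polynomial.X ^ (i : ℕ)) ∧
      (∀ W : Submodule K L, W = Submodule.span K (Set.range a) → prod X W ≤ W → W ≤ R →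
        prod W X ≤ W ∧ prod W P = ⊥ ∧ prod W (prod W W) = ⊥ ∧ prod (prod W W) W = ⊥ ∧
        prod W W ≤ Z ∧ (W ≤ Leib K L ∨ Leib K L ≤ Z)) by
    obtain ⟨k, a, c, hli, haR, hrel, hlast, hc0, hirr, htable⟩ := table
    have hWR : Submodule.span K (Set.range a) ≤ R := Submodule.span_le.mpr (by
      rintro _ ⟨i, rfl⟩; exact haR i)
    have haW : ∀ i, a i ∈ Submodule.span K (Set.range a) := fun i =>
      Submodule.subset_span ⟨i, rfl⟩
    have hxW : ∀ w ∈ Submodule.span K (Set.range a), x * w ∈ Submodule.span K (Set.range a) := by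
      intro w hw
      have hle : Submodule.span K (Set.range a) ≤
          (Submodule.span K (Set.range a)).comap (LinearMap.mulLeft K x) :=
        Submodule.span_le.mpr (by
          rintro _ ⟨i, rfl⟩
          refine Fin.lastCases ?_ (fun i => ?_) i
          · simp only [Submodule.comap_coe, Set.mem_preimage, LinearMap.mulLeft_apply, hlast]
            exact Submodule.sum_mem _ fun i _ => Submodule.smul_mem _ _ (haW i)
          · simp only [Submodule.comap_coe, Set.mem_preimage, LinearMap.mulLeft_apply, hrel]
            exact haW _)
      exact hle hw
    have hXW := hXS hxW
    obtain ⟨hWX, hWP, hWQ, hQW, hQZ, hdich⟩ := htable _ rfl hXW hWR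
    set W := Submodule.span K (Set.range a) with hW
    obtain ⟨hclosed, hideal, hcube⟩ :=
      table_consequences hPL hXX hXP hXW hWX hWP hWQ hQW
    have hT := htop _ hclosed
      (Submodule.mem_sup_left (Submodule.mem_span_singleton_self x)) (a 0)
      (Submodule.mem_sup_right (Submodule.mem_sup_left (haW 0))) (haR 0) (hli.ne_zero 0)
    have hNZ : P ⊔ prod W W ≤ Z := sup_le hPZ hQZ
    have hWNA : W ⊔ (P ⊔ prod W W) ≤ A := sup_le (hWR.trans hRA)
      (sup_le ((prod_mono le_top le_top).trans hA) ((prod_mono le_top le_top).trans hA))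
    have hWN : W ⊔ (P ⊔ prod W W) = A := by
      refine hWNA.antisymm ?_
      -- Modular law: intersect `L = (W + N) + span {x}` with `A`.
      have h := sup_inf_assoc_of_le X hWNA
      rw [sup_comm, hT, top_inf_eq, inf_comm, hAx.inf_eq_bot, sup_bot_eq] at h
      exact h.le
    refine ⟨A, P ⊔ prod W W, x, k, a, c, hrad, hAx, hx0, hideal hT, hli,
      hcompl.symm.disjoint.mono hWR hNZ, hWN, hrel, hlast, hc0, hirr, rfl, ?_, ?_⟩
    -- In fact `A³ = 0`.
    · rw [← hWN, hcube]; exact bot_le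
    rcases hdich with hWL | hLZ
    · left
      have hmul : ∀ u, (x + a 0) * u = x * u := fun u => by
        rw [add_mul, Leib_mul (hWL (haW 0)), add_zero]
      have hstg : ∀ u ∈ gen K (x + a 0), x * u ∈ gen K (x + a 0) := fun u hu =>
        hmul u ▸ prod_gen_le _ (mul_mem_prod (self_mem_gen _) hu)
      have hpow : ∀ m, (LinearMap.mulLeft K x ^ m) (x + a 0) ∈ gen K (x + a 0) := by
        intro m
        induction m with
        | zero => exact self_mem_gen _
        | succ m ih => rw [pow_succ', Module.End.mul_apply]; exact hstg _ ih
      -- `x + a 0` acts from the left as `x` does; the `n`th power kills `x`, and injectivity on `R`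
      -- recovers `a 0`.
      have ha0 : a 0 ∈ gen K (x + a 0) := by
        refine mem_of_pow_apply_mem hstR hinjR hstg n (haR 0) ?_
        have := hpow n
        rwa [map_add, LinearMap.mem_ker.mp hxker, zero_add] at this
      have hxg : x ∈ gen K (x + a 0) := by
        simpa using Submodule.sub_mem _ (self_mem_gen (x + a 0)) ha0
      exact ⟨x + a 0, htop _ (prod_gen_le _) hxg (a 0) ha0 (haR 0) (hli.ne_zero 0)⟩
    · right
      intro u hu
      obtain ⟨w, hw, v, hv, rfl⟩ := Submodule.mem_sup.mp (hWN ▸ hLA hu)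
      have hwZ : w ∈ Z := by simpa using Z.sub_mem (hLZ hu) (hNZ hv)
      rw [hRZ w (hWR hw) hwZ, zero_add]
      exact hv
  by_cases hLR : Leib K L ⊓ R = ⊥
  · have hLZ : Leib K L ≤ Z := hZ_of _ (fun u hu => mul_Leib hu x) hLR
    have hRL : ∀ u ∈ R, ∀ v ∈ Leib K L, u * v = 0 := fun u hu v hv =>
      hRZ _ (hmulR (hLZ hv) hu).2 (hLZ (mul_Leib hv u))
    have hQid := prod_isIdeal (isIdeal_of_prod_top_le hA)
    -- If `A²` met `R`, then `⟨x⟩ + A² = L`, so `A = P + A²`; nilpotency would give `A ≤ P ≤ Z`,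
    -- although `A` contains `R`.
    have hAAZ : prod A A ≤ Z := by
      refine hZ_of _ (fun u hu => (hQid u hu x).1) ?_
      by_contra hne
      obtain ⟨w, hw, hw0⟩ := Submodule.exists_mem_ne_zero_of_ne_bot hne
      have hT := htop (gen K x ⊔ prod A A) (by
        rw [prod_sup_left, prod_sup_right]
        refine sup_le (sup_le ((prod_gen_le x).trans le_sup_left) ?_) ?_
        · exact (prod_le.mpr fun s _ t ht => (hQid t ht s).1).trans le_sup_right
        · exact (prod_le.mpr fun s hs t _ => (hQid s hs t).2).trans le_sup_right)
        (Submodule.mem_sup_left (self_mem_gen x)) w (Submodule.mem_sup_right hw.1) hw.2 hw0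
      have hAP : A ≤ P := by
        refine le_of_le_sup_prod hAnil hPL ?_
        have hle : P ⊔ prod A A ≤ A := sup_le (hPL.trans hLA) ((prod_mono le_top le_top).trans hA)
        have h := sup_inf_assoc_of_le X hle
        have hT' : (P ⊔ prod A A) ⊔ X = ⊤ := by
          rw [eq_top_iff, ← hT]
          refine sup_le ((gen_le_span_sup x).trans ?_) ?_
          · exact sup_le le_sup_right (le_sup_left.trans le_sup_left)
          · exact le_sup_right.trans le_sup_left
        rw [hT', top_inf_eq, inf_comm, hAx.inf_eq_bot, sup_bot_eq] at h
        exact h.le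
      exact hw0 (hRZ w hw.2 (hPZ (hAP (hRA hw.2))))
    obtain ⟨k, a, c, h1, h2, h3, h4, h5, h6⟩ :=
      exists_cyclic_family (LinearMap.mulLeft K x) R hstR hRne hinjR
    refine ⟨k, a, c, h1, h2, h3, h4, h5, h6, fun W _ hXW hWR => ?_⟩
    have hWA := hWR.trans hRA
    have hQA : prod W W ≤ prod A A := prod_mono hWA hWA
    have hAA : prod A A ≤ A := (prod_mono le_top le_top).trans hA
    refine ⟨?_, ?_, ?_, ?_, hQA.trans hAAZ, Or.inr hLZ⟩
    -- `wu + uw` lies in `Leib(L) ∩ R = 0`, so right multiplication by `x` on `W` is minus the left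
    -- one.
    · refine prod_le.mpr fun w hw u hu => ?_
      have hz : w * u + u * w = 0 := (Submodule.mem_bot K).mp (hLR ▸ ⟨mul_add_mul_mem_Leib w u,
        R.add_mem (hmulR (hgenker (hXgen hu)) (hWR hw)).2
          (hmulR (hgenker (hXgen hu)) (hWR hw)).1⟩)
      rw [eq_neg_of_add_eq_zero_left hz]
      exact W.neg_mem (hXW (mul_mem_prod hu hw))
    · exact le_bot_iff.mp (prod_le.mpr fun w hw p hp => by simp [hRL w (hWR hw) p (hPL hp)])
    -- The product lies in `R`, since `W ≤ R` and `W² ≤ Z`, and also in `A² ≤ Z`.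
    · refine le_bot_iff.mp (prod_le.mpr fun w hw q hq => ?_)
      exact hRZ _ (hmulR (hAAZ (hQA hq)) (hWR hw)).2
        (hAAZ (mul_mem_prod (hWA hw) (hAA (hQA hq))))
    · refine le_bot_iff.mp (prod_le.mpr fun q hq w hw => ?_)
      exact hRZ _ (hmulR (hAAZ (hQA hq)) (hWR hw)).1
        (hAAZ (mul_mem_prod (hAA (hQA hq)) (hWA hw)))
  · obtain ⟨k, a, c, h1, h2, h3, h4, h5, h6⟩ :=
      exists_cyclic_family (LinearMap.mulLeft K x) (Leib K L ⊓ R)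
        (fun u hu => ⟨mul_Leib hu.1 x, hstR u hu.2⟩) hLR (fun u hu => hinjR u hu.2)
    refine ⟨k, a, c, h1, fun i => (h2 i).2, h3, h4, h5, h6, fun W hW _ _ => ?_⟩
    have hWL : W ≤ Leib K L := hW ▸ Submodule.span_le.mpr (by
      rintro _ ⟨i, rfl⟩; exact (h2 i).1)
    have h0 := fun T => prod_Leib_left hWL T
    refine ⟨by simp [h0], h0 _, h0 _, ?_, by simp [h0], Or.inl hWL⟩
    rw [h0 W]
    exact prod_Leib_left bot_le W
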